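/- **Lemma 4.1 (Upper bound on the Gauss curvature).** Let $n\ge 2$, $0<p<1$, let $\Phi:\mathbb{S}^{n-1}\to(0,\infty)$ be a smooth function, and let $R_->0$ and $R_+$ be real numbers. For a convex body $K\subset\mathbb{R}^n$ let $s_K(z)=\max_{y\in K}\langle z,y\rangle$, $z\in\mathbb{S}^{n-1}$, denote its support function, and for a smooth function $s$ on $\mathbb{S}^{n-1}$ put $S_{n-1}=\det_{\bar g}(\bar\nabla_i\bar\nabla_j s+\bar g_{ij}s)$, where $\bar g$ and $\bar\nabla$ are the standard metric and Levi-Civita connection of $\mathbb{S}^{n-1}$. There is a constant $C>0$, depending only on $p,R_-,R_+$ and $\Phi$ (hence on $n$, as $\Phi$ is a function on $\mathbb{S}^{n-1}$), with the following property. Let $t_0$ be a real number and let $\{K_t\}_{t\in[0,t_0]}$ be a smooth, strictly convex solution of $$\partial_t s(z,t)=\Phi(z)\,S_{n-1}(z,t)^{\frac{p}{n-1}},\qquad s(z,t)=s_{K_t}(z),$$ that is, $s$ is smooth on $\mathbb{S}^{n-1}\times[0,t_0]$, satisfies this equation there, and $\bar\nabla_i\bar\nabla_j s+\bar g_{ij}s$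 is positive definite everywhere. If $R_-\le s(z,t)\le R_+$ for all $z\in\mathbb{S}^{n-1}$ and $t\in[0,t_0]$, then for every $t\in(0,t_0]$ the Gauss curvature $\mathcal{K}$ of $\partial K_t$ satisfies $$\mathcal{K}(x)\le C\,t^{\frac{n-1}{p-1}}\qquad\text{for all }x\in\partial K_t .$$ -/

import Mathlib

open scoped Manifold ContDiff RealInnerProductSpace

noncomputable section

namespace ExpandingGaussFlow

variable {E : Type*} [NormedAddCommGroup E] [InnerProductSpace ℝ E] [FiniteDimensional ℝ E]

/-- The unit sphere of `E`. -/
abbrev USphere (E : Type*) [NormedAddCommGroup E] : Type _ := Metric.sphere (0 : E) 1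

/-- The tangent hyperplane `z^⊥` of the unit sphere at the unit vector `z`. -/
abbrev Tan (z : E) : Submodule ℝ E := (ℝ ∙ z)ᗮ

/-- The support function of a convex body, `s_K(z) = max {⟨z, y⟩ | y ∈ K}`, as a function on the
unit sphere (the maximum over the compact set `K` is attained on its boundary). -/
def supportFunction (K : ConvexBody E) (z : USphere E) : ℝ :=
  sSup ((fun y : E => ⟪(z : E), y⟫) '' (K : Set E))

/-- The extension `y ↦ f (y / |y|)` of a function on the unit sphere to `E \ {0}`
(with the irrelevant value `0` at the origin). -/
def radialExt {F : Type*} [Zero F] (f : USphere E → F) (y : E) : F :=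
  open scoped Classical in
  if hy : y = 0 then 0
  else f ⟨‖y‖⁻¹ • y, by
    simp [norm_smul, inv_mul_cancel₀ (norm_ne_zero_iff.mpr hy)]⟩

/-- The gradient on the round unit sphere, as a vector of `E`. The extension is constant along
rays, so its Euclidean gradient at a point of the sphere is tangent to the sphere, and it is the
Riemannian gradient there. -/
def sphereGradient (f : USphere E → ℝ) (z : USphere E) : E :=
  gradient (radialExt f) (z : E)

/-- The covariant derivative on the round unit sphere of a tangent vector field `X`, in the
direction `v ∈ T_z`: the Levi-Civita connection of the sphere is the tangential part of the
Euclidean derivative. -/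
def covariantDeriv (X : USphere E → E) (z : USphere E) : Tan (z : E) →L[ℝ] Tan (z : E) :=
  (Tan (z : E)).orthogonalProjectionOnto ∘L fderiv ℝ (radialExt X) (z : E) ∘L (Tan (z : E)).subtypeL

/-- The covariant Hessian on the round unit sphere, `v ↦ ∇_v (grad f)`; the metric turns it into
the bilinear form `∇_i ∇_j f`. -/
def sphereHessian (f : USphere E → ℝ) (z : USphere E) : Tan (z : E) →L[ℝ] Tan (z : E) :=
  covariantDeriv (sphereGradient f) z

/-- The radii of curvature `𝔯_ij = ∇_i ∇_j s + s g_ij`, as an endomorphism of `T_z` (one index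
raised with the round metric `g`). -/
def radiiOfCurvature (s : USphere E → ℝ) (z : USphere E) : Tan (z : E) →L[ℝ] Tan (z : E) :=
  sphereHessian s z + s z • ContinuousLinearMap.id ℝ (Tan (z : E))

/-- `S_{n-1} = det_g (∇_i ∇_j s + s g_ij)`. -/
def detRadii (s : USphere E → ℝ) (z : USphere E) : ℝ :=
  LinearMap.det (radiiOfCurvature s z : Tan (z : E) →ₗ[ℝ] Tan (z : E))

/-- `z` is an outward unit normal vector of the convex set `K` at `x`. -/
def IsOutwardUnitNormal (K : Set E) (x z : E) : Prop :=
  ‖z‖ = 1 ∧ ∀ y ∈ K, ⟪z, y - x⟫ ≤ 0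

/-- The Gauss map of a convex body: it sends a boundary point `x` to the outward unit normal
at `x` (which is unique when the boundary is smooth). -/
def gaussMap (K : ConvexBody E) (x : E) : E :=
  Classical.epsilon (IsOutwardUnitNormal (K : Set E) x)

/-- The Weingarten map of the boundary of `K` at `x`: the differential of the Gauss map along the
boundary, as an endomorphism of the tangent hyperplane at `x`. -/
def weingartenMap (K : ConvexBody E) (x : E) :
    Tan (gaussMap K x) →L[ℝ] Tan (gaussMap K x) :=
  (Tan (gaussMap K x)).orthogonalProjectionOnto ∘L
    fderivWithin ℝ (gaussMap K) (frontier (K : Set E)) x ∘L (Tan (gaussMap K x)).subtypeL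

/-- The Gauss curvature of the boundary of `K` at `x`: the determinant of the Weingarten map,
that is, the product of the principal curvatures. -/
def gaussCurvature (K : ConvexBody E) (x : E) : ℝ :=
  LinearMap.det (weingartenMap K x : Tan (gaussMap K x) →ₗ[ℝ] Tan (gaussMap K x))

/-- `{K_t}`, `t ∈ [0, t₀]`, is a smooth, strictly convex solution in `ℝⁿ`, `n = m + 1`, of
`∂_t s = Φ S_{n-1}^{p/(n-1)}`, where `s(·, t)` is the support function of `K_t`. -/
structure IsSmoothStrictlyConvexSolution (m : ℕ) (p t₀ : ℝ)
    (Φ : USphere (EuclideanSpace ℝ (Fin (m + 1))) → ℝ)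
    (K : ℝ → ConvexBody (EuclideanSpace ℝ (Fin (m + 1)))) : Prop where
  /-- `s` is smooth on `𝕊ⁿ⁻¹ × [0, t₀]`. -/
  smooth : ContMDiffOn ((𝓡 m).prod 𝓘(ℝ, ℝ)) 𝓘(ℝ, ℝ) ∞
    (fun q : USphere (EuclideanSpace ℝ (Fin (m + 1))) × ℝ => supportFunction (K q.2) q.1)
    (Set.univ ×ˢ Set.Icc 0 t₀)
  /-- Each `K_t` is strictly convex: the matrix of its radii of curvature is positive definite. -/
  strictlyConvex : ∀ t ∈ Set.Icc 0 t₀, ∀ z : USphere (EuclideanSpace ℝ (Fin (m + 1))),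
    ∀ v : Tan (z : EuclideanSpace ℝ (Fin (m + 1))), v ≠ 0 →
      0 < ⟪radiiOfCurvature (supportFunction (K t)) z v, v⟫
  /-- The evolution equation. The time derivative is one-sided at `0` and at `t₀`. -/
  evolution : ∀ t ∈ Set.Icc 0 t₀, ∀ z : USphere (EuclideanSpace ℝ (Fin (m + 1))),
    HasDerivWithinAt (fun τ => supportFunction (K τ) z)
      (Φ z * detRadii (supportFunction (K t)) z ^ (p / m)) (Set.Icc 0 t₀) t

end ExpandingGaussFlow

end

/-! Write m = n - 1, A = ∇²s + s g, S = det A, and ψ = Φ S^(p/m) for the speed. Since ∂_t A = ∇²ψ +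
ψ g, at a spatial minimum of ψ one has ∂_t A ≥ ψ g. Hence ∂_t S = S tr(A⁻¹ ∂_t A) ≥ ψ S tr(A⁻¹) ≥ m
ψ S^(1 - 1/m), the last step by the inequality of arithmetic and geometric means
(`exists_hasDerivAt_det_ge`, `exists_hasDerivAt_detRadii_ge`).

For the power ψ^((1-p)/p) = Φ^((1-p)/p) S^((1-p)/m) all powers of S cancel: at such a minimum its
time derivative is at least (1-p) Φ^(1/p), a positive constant on the compact sphere. The minimum
principle then gives ψ^((1-p)/p) ≥ c t whatever the initial body, which is a lower bound on S
(`mul_le_speed_rpow`).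

It remains to see that the Gauss curvature is 1/S (`gaussCurvature_mul_detRadii`). The map X = s z +
∇s parametrizes the boundary by its normal and has differential A on tangent vectors. Positivity of
A and of s makes normals unique and the Gauss map differentiable; differentiating ν ∘ X = id gives
dν ∘ A = id. The lower bound on s supplies its positivity and puts the origin in the interior of the
body. -/

namespace ExpandingGaussFlow

/-! ### Determinants of positive definite operators -/

/-- The derivative of the determinant at a diagonal matrix. -/
theorem hasDerivAt_det_of_eq_diagonal {n : Type*} [Fintype n] [DecidableEq n]
    {M : ℝ → Matrix n n ℝ} {B : Matrix n n ℝ} {lam : n → ℝ} {t : ℝ}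
    (hM : ∀ i j, HasDerivAt (fun τ => M τ i j) (B i j) t) (h : M t = Matrix.diagonal lam) :
    HasDerivAt (fun τ => (M τ).det) (∑ i, (∏ j ∈ Finset.univ.erase i, lam j) * B i i) t := by
  have key : HasDerivAt (fun τ => ∑ σ : Equiv.Perm n, ((Equiv.Perm.sign σ : ℤ) : ℝ) *
      ∏ i, M τ (σ i) i) (∑ σ : Equiv.Perm n, ((Equiv.Perm.sign σ : ℤ) : ℝ) *
      ∑ i, (∏ j ∈ Finset.univ.erase i, M t (σ j) j) • B (σ i) i) t :=
    HasDerivAt.fun_sum fun σ _ =>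
      (HasDerivAt.fun_finsetProd fun i _ => hM (σ i) i).const_mul _
  convert! key using 1
  · ext τ
    exact Matrix.det_apply' _
  -- A nontrivial permutation moves at least two indices, so after one factor is differentiated an
  -- off-diagonal zero remains in the product.
  · rw [Finset.sum_eq_single (1 : Equiv.Perm n)]
    · simp [h]
    · intro σ _ hσ
      rw [Finset.sum_eq_zero, mul_zero]
      intro i _
      have : ∃ j, j ≠ i ∧ σ j ≠ j := by
        by_contra! hc
        apply hσ
        have hi : σ i = i := by
          by_contra hne
          have h1 := hc (σ i) hne
          exact hne (σ.injective h1)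
        ext j
        by_cases hj : j = i
        · simp [hj, hi]
        · simp [hc j hj]
      obtain ⟨j, hji, hj⟩ := this
      rw [Finset.prod_eq_zero (i := j) (by simp [hji]) (by rw [h, Matrix.diagonal_apply_ne _ hj]),
        zero_smul]
    · simp

/-- The inequality of arithmetic and geometric means for the sum of reciprocals. -/
theorem card_mul_prod_rpow_le_sum_inv {n : Type*} [Fintype n] [Nonempty n] {lam : n → ℝ}
    (h : ∀ i, 0 < lam i) :
    Fintype.card n * (∏ i, lam i) ^ (-(1 / (Fintype.card n : ℝ))) ≤ ∑ i, (lam i)⁻¹ := by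
  have hc : (0 : ℝ) < Fintype.card n := by exact_mod_cast Fintype.card_pos
  have := Real.geom_mean_le_arith_mean_weighted Finset.univ
    (fun _ : n => 1 / (Fintype.card n : ℝ)) (fun i => (lam i)⁻¹) (fun _ _ => by positivity)
    (by simp [hc.ne']) (fun i _ => (inv_pos.2 (h i)).le)
  rw [Real.finsetProd_rpow _ _ (fun i _ => (inv_pos.2 (h i)).le), ← Finset.mul_sum,
    Finset.prod_inv_distrib, Real.inv_rpow (Finset.prod_nonneg fun i _ => (h i).le),
    ← Real.rpow_neg (Finset.prod_nonneg fun i _ => (h i).le)] at this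
  calc _ ≤ (Fintype.card n : ℝ) * (1 / (Fintype.card n : ℝ) * ∑ i, (lam i)⁻¹) := by gcongr
    _ = _ := by field_simp

section Operator

variable {V : Type*} [NormedAddCommGroup V] [InnerProductSpace ℝ V] [FiniteDimensional ℝ V]

theorem det_pos_of_posDef {A : V →L[ℝ] V} (hsymm : (A : V →ₗ[ℝ] V).IsSymmetric)
    (hpos : ∀ v, v ≠ 0 → 0 < ⟪A v, v⟫) : 0 < LinearMap.det (A : V →ₗ[ℝ] V) := by
  rw [hsymm.det_eq_prod_eigenvalues rfl]
  refine Finset.prod_pos fun i _ => ?_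
  have h := hpos _ ((hsymm.eigenvectorBasis rfl).orthonormal.ne_zero i)
  have h2 := hsymm.apply_eigenvectorBasis rfl i
  rw [ContinuousLinearMap.coe_coe] at h2
  rw [h2, inner_smul_left, real_inner_self_eq_norm_sq,
    (hsymm.eigenvectorBasis rfl).orthonormal.1 i] at h
  simpa using h

/-- If `A' ≥ ψ` at a time at which `A` is symmetric and positive definite, then
`(det A)' ≥ m ψ (det A)^{1 - 1/m}`. -/
theorem exists_hasDerivAt_det_ge {m : ℕ} (hm : 1 ≤ m) (hdim : Module.finrank ℝ V = m)
    {A : ℝ → V →L[ℝ] V} {B : V → V → ℝ} {t ψ : ℝ} (hψ : 0 ≤ ψ)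
    (hA : ∀ v w, HasDerivAt (fun τ => ⟪A τ v, w⟫) (B v w) t)
    (hsymm : (A t : V →ₗ[ℝ] V).IsSymmetric) (hpos : ∀ v, v ≠ 0 → 0 < ⟪A t v, v⟫)
    (hB : ∀ v, ψ * ⟪v, v⟫ ≤ B v v) :
    ∃ d, HasDerivAt (fun τ => LinearMap.det (A τ : V →ₗ[ℝ] V)) d t ∧
      m * ψ * LinearMap.det (A t : V →ₗ[ℝ] V) *
        LinearMap.det (A t : V →ₗ[ℝ] V) ^ (-(1 / (m : ℝ))) ≤ d := by
  set b := hsymm.eigenvectorBasis hdim with hb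
  set lam := hsymm.eigenvalues hdim with hlam
  have hAb : ∀ i, A t (b i) = lam i • b i := fun i => hsymm.apply_eigenvectorBasis hdim i
  have hpos' : ∀ i, 0 < lam i := by
    intro i
    have h := hpos _ (b.orthonormal.ne_zero i)
    rw [hAb, inner_smul_left, real_inner_self_eq_norm_sq, b.orthonormal.1 i] at h
    simpa using h
  have hdetM : ∀ T : V →L[ℝ] V, LinearMap.det (T : V →ₗ[ℝ] V)
      = (Matrix.of fun i j => ⟪T (b j), b i⟫).det := by
    intro T
    rw [← LinearMap.det_toMatrix b.toBasis]
    congr 1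
    ext i j
    simp [LinearMap.toMatrix_apply, b.repr_apply_apply, real_inner_comm]
  have hdet : LinearMap.det (A t : V →ₗ[ℝ] V) = ∏ i, lam i := by
    rw [hsymm.det_eq_prod_eigenvalues hdim]
    simp [hlam]
  have hdiag : (Matrix.of fun i j => ⟪A t (b j), b i⟫) = Matrix.diagonal lam := by
    ext i j
    rw [Matrix.of_apply, hAb, inner_smul_left, b.inner_eq_ite, Matrix.diagonal_apply]
    by_cases hij : i = j
    · simp [hij]
    · simp [hij, Ne.symm hij]
  refine ⟨_, (hasDerivAt_det_of_eq_diagonal (M := fun τ => Matrix.of fun i j => ⟪A τ (b j), b i⟫)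
    (B := Matrix.of fun i j => B (b j) (b i)) (fun i j => hA _ _) hdiag).congr_of_eventuallyEq
    (Filter.Eventually.of_forall fun τ => hdetM _), ?_⟩
  have : Nonempty (Fin m) := ⟨⟨0, hm⟩⟩
  have amgm := card_mul_prod_rpow_le_sum_inv hpos'
  rw [Fintype.card_fin] at amgm
  have hP : 0 < ∏ i, lam i := Finset.prod_pos fun i _ => hpos' i
  rw [hdet]
  -- In the eigenbasis of A the derivative of the determinant is the sum of cofactors times the
  -- diagonal entries of B, each at least ψ.
  calc (m : ℝ) * ψ * (∏ i, lam i) * (∏ i, lam i) ^ (-(1 / (m : ℝ)))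
      = ψ * (∏ i, lam i) * (m * (∏ i, lam i) ^ (-(1 / (m : ℝ)))) := by ring
    _ ≤ ψ * (∏ i, lam i) * ∑ i, (lam i)⁻¹ := by gcongr
    _ = ∑ i, (∏ j ∈ Finset.univ.erase i, lam j) * ψ := by
      rw [Finset.mul_sum]
      refine Finset.sum_congr rfl fun i _ => ?_
      rw [← Finset.mul_prod_erase Finset.univ lam (Finset.mem_univ i)]
      have := (hpos' i).ne'
      field_simp
    _ ≤ _ := by
      refine Finset.sum_le_sum fun i _ => ?_
      refine mul_le_mul_of_nonneg_left ?_ (Finset.prod_nonneg fun j _ => (hpos' j).le)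
      have := hB (b i)
      rw [real_inner_self_eq_norm_sq, b.orthonormal.1 i] at this
      simpa using this

end Operator

/-! ### Second derivatives: minima and commutation -/

section Calculus

theorem two_le_infty : (2 : WithTop ℕ∞) ≤ ∞ := WithTop.coe_le_coe.2 le_top

variable {E : Type*} [NormedAddCommGroup E] [NormedSpace ℝ E]

/-- The second order necessary condition for a local minimum. -/
theorem fderiv_fderiv_nonneg_of_isLocalMin {f : E → ℝ} {x : E} (hf : ContDiffAt ℝ 2 f x)
    (hmin : IsLocalMin f x) (v : E) : 0 ≤ fderiv ℝ (fderiv ℝ f) x v v := by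
  by_contra! hneg
  have hline : ∀ τ : ℝ, HasDerivAt (fun τ : ℝ => x + τ • v) v τ := fun τ => by
    simpa using ((hasDerivAt_id τ).smul_const v).const_add x
  have hcont : Filter.Tendsto (fun τ : ℝ => x + τ • v) (nhds 0) (nhds x) := by
    have := (hline 0).continuousAt.tendsto
    simpa using this
  have hev : ∀ᶠ y in nhds x, DifferentiableAt ℝ f y :=
    (hf.eventually (by simp)).mono fun y hy => hy.differentiableAt (by simp)
  obtain ⟨g, hg⟩ : ∃ g : ℝ → ℝ, g = fun τ => f (x + τ • v) := ⟨_, rfl⟩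
  have hg1 : ∀ᶠ τ in nhds (0 : ℝ), HasDerivAt g (fderiv ℝ f (x + τ • v) v) τ :=
    (hcont.eventually hev).mono fun τ hτ => hg ▸ hτ.hasFDerivAt.comp_hasDerivAt τ (hline τ)
  have hderiv : deriv g =ᶠ[nhds 0] fun τ => fderiv ℝ f (x + τ • v) v :=
    hg1.mono fun τ hτ => hτ.deriv
  have h2 : HasFDerivAt (fderiv ℝ f) (fderiv ℝ (fderiv ℝ f) x) (x + (0 : ℝ) • v) := by
    rw [zero_smul, add_zero]
    exact ((hf.fderiv_right (m := 1) (by norm_num)).differentiableAt (by simp)).hasFDerivAt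
  have hg2 : HasDerivAt (deriv g) (fderiv ℝ (fderiv ℝ f) x v v) 0 := by
    have h3 : HasDerivAt (fun τ : ℝ => fderiv ℝ f (x + τ • v) v) (fderiv ℝ (fderiv ℝ f) x v v) 0 :=
      (((ContinuousLinearMap.apply ℝ ℝ v).hasFDerivAt.comp (x + (0 : ℝ) • v) h2).comp_hasDerivAt
        (0 : ℝ) (hline 0) :)
    exact h3.congr_of_eventuallyEq hderiv
  have hmin' : IsLocalMin g 0 := by
    have : ∀ᶠ τ in nhds (0 : ℝ), f x ≤ f (x + τ • v) := hcont.eventually hmin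
    filter_upwards [this] with τ hτ
    simpa [hg] using hτ
  have hd0 : deriv g 0 = 0 := hmin'.deriv_eq_zero
  -- A negative second derivative makes 0 a local maximum as well, so g is locally constant and its
  -- second derivative vanishes.
  have hmax : IsLocalMax g 0 := isLocalMax_of_deriv_deriv_neg (by rw [hg2.deriv]; exact hneg) hd0
    hg1.self_of_nhds.continuousAt
  have hconst : g =ᶠ[nhds 0] fun _ => g 0 := by
    filter_upwards [hmin', hmax] with τ h1 h2
    exact le_antisymm h2 h1
  have hd : deriv g =ᶠ[nhds 0] fun _ => 0 := by
    have := hconst.deriv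
    simpa using this
  have : deriv (deriv g) 0 = 0 := by
    rw [hd.deriv_eq]; simp
  rw [hg2.deriv] at this
  exact hneg.ne this

theorem contDiffOn_fderiv_apply {f : E → ℝ} {O : Set E} (hO : IsOpen O) (hf : ContDiffOn ℝ ∞ f O)
    (u : E) : ContDiffOn ℝ ∞ (fun x => fderiv ℝ f x u) O :=
  (hf.fderiv_of_isOpen hO (by simp)).clm_apply contDiffOn_const

theorem fderiv_fderiv_apply {f : E → ℝ} {x : E} (hf : ContDiffAt ℝ 2 f x) (u v : E) :
    fderiv ℝ (fun y => fderiv ℝ f y v) x u = fderiv ℝ (fderiv ℝ f) x u v := by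
  have h := ((hf.fderiv_right (m := 1) (by norm_num)).differentiableAt (by simp)).hasFDerivAt
  have := (h.clm_apply (hasFDerivAt_const v x)).fderiv
  rw [this]
  simp

theorem fderiv_apply_comm {f : E → ℝ} {x : E} (hf : ContDiffAt ℝ 2 f x) (u v : E) :
    fderiv ℝ (fun y => fderiv ℝ f y v) x u = fderiv ℝ (fun y => fderiv ℝ f y u) x v := by
  rw [fderiv_fderiv_apply hf, fderiv_fderiv_apply hf]
  exact hf.isSymmSndFDerivAt (by simp) u v

/-- In an open set on which `F` is smooth, the time derivative commutes with the spatial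
Hessian. -/
theorem hasDerivAt_fderiv_fderiv {F : E × ℝ → ℝ} {O : Set (E × ℝ)} (hO : IsOpen O)
    (hF : ContDiffOn ℝ ∞ F O) {z : E} {t : ℝ} (hzt : (z, t) ∈ O) (v w : E) :
    HasDerivAt (fun τ => fderiv ℝ (fderiv ℝ fun y => F (y, τ)) z v w)
      (fderiv ℝ (fderiv ℝ fun y => fderiv ℝ F (y, t) (0, 1)) z v w) t := by
  have htwo : ∀ {G : E × ℝ → ℝ}, ContDiffOn ℝ ∞ G O → ∀ q ∈ O, ContDiffAt ℝ 2 G q :=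
    fun hG q hq => (hG.contDiffAt (hO.mem_nhds hq)).of_le (two_le_infty)
  have hslice : ∀ (y : E) (τ : ℝ), ContDiff ℝ ∞ fun y : E => (y, τ) := fun _ τ =>
    contDiff_id.prodMk contDiff_const
  have hfd : ∀ {G : E × ℝ → ℝ}, ContDiffOn ℝ ∞ G O → ∀ {y τ}, (y, τ) ∈ O → ∀ u,
      fderiv ℝ (fun y => G (y, τ)) y u = fderiv ℝ G (y, τ) (u, 0) := by
    intro G hG y τ hq u
    have h1 : HasFDerivAt (fun y : E => (y, τ)) (ContinuousLinearMap.inl ℝ E ℝ) y :=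
      (hasFDerivAt_id y).prodMk (hasFDerivAt_const τ y)
    have h2 := ((htwo hG _ hq).differentiableAt (by simp)).hasFDerivAt.comp y h1
    change fderiv ℝ (G ∘ fun y => (y, τ)) y u = _
    rw [h2.fderiv]
    simp
  have hHess : ∀ {G : E × ℝ → ℝ}, ContDiffOn ℝ ∞ G O → ∀ {y τ}, (y, τ) ∈ O →
      fderiv ℝ (fderiv ℝ fun y => G (y, τ)) y v w
        = fderiv ℝ (fun q => fderiv ℝ G q (w, 0)) (y, τ) (v, 0) := by
    intro G hG y τ hq
    have hc : ContDiffAt ℝ 2 (fun y => G (y, τ)) y :=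
      (htwo hG _ hq).comp y ((hslice y τ).contDiffAt.of_le (two_le_infty))
    rw [← fderiv_fderiv_apply hc, ← hfd (contDiffOn_fderiv_apply hO hG (w, 0)) hq]
    have hev : (fun y => fderiv ℝ (fun y => G (y, τ)) y w) =ᶠ[nhds y]
        fun y => fderiv ℝ G (y, τ) (w, 0) := by
      have : ∀ᶠ y' in nhds y, (y', τ) ∈ O :=
        (hslice y τ).continuous.continuousAt.eventually (hO.mem_nhds hq)
      filter_upwards [this] with y' hy'
      exact hfd hG hy' w
    rw [hev.fderiv_eq]
  have hFw := contDiffOn_fderiv_apply hO hF (w, (0 : ℝ))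
  have hFvw := contDiffOn_fderiv_apply hO hFw (v, (0 : ℝ))
  have hFt := contDiffOn_fderiv_apply hO hF ((0 : E), (1 : ℝ))
  have hline : HasDerivAt (fun τ : ℝ => (z, τ)) ((0 : E), (1 : ℝ)) t :=
    (hasDerivAt_const t z).prodMk (hasDerivAt_id t)
  have hmain := ((htwo hFvw _ hzt).differentiableAt (by simp)).hasFDerivAt.comp_hasDerivAt t hline
  refine (hmain.congr_of_eventuallyEq ?_).congr_deriv ?_
  · have : ∀ᶠ τ in nhds t, (z, τ) ∈ O := hline.continuousAt.eventually (hO.mem_nhds hzt)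
    filter_upwards [this] with τ hτ
    exact hHess hF hτ
  -- Symmetry of second derivatives is used twice, moving the time derivative past one spatial
  -- direction at a time.
  · rw [hHess hFt hzt, fderiv_apply_comm (htwo hFw _ hzt)]
    have hev : (fun q => fderiv ℝ (fun q => fderiv ℝ F q (w, 0)) q (0, 1)) =ᶠ[nhds (z, t)]
        fun q => fderiv ℝ (fun q => fderiv ℝ F q (0, 1)) q (w, 0) := by
      filter_upwards [hO.mem_nhds hzt] with q hq
      exact fderiv_apply_comm (htwo hF _ hq) _ _
    rw [hev.fderiv_eq]

end Calculus

/-! ### Calculus on the sphere through radial extensions -/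

section Sphere

variable {E : Type*} [NormedAddCommGroup E]

theorem norm_coe_usphere (z : USphere E) : ‖(z : E)‖ = 1 := norm_eq_of_mem_sphere z

theorem coe_usphere_ne_zero (z : USphere E) : (z : E) ≠ 0 :=
  norm_ne_zero_iff.1 (by rw [norm_coe_usphere]; exact one_ne_zero)

theorem eventually_ne_zero_nhds (z : USphere E) : ∀ᶠ y in nhds (z : E), y ≠ 0 :=
  isOpen_ne.mem_nhds (coe_usphere_ne_zero z)

variable [InnerProductSpace ℝ E]

/-- The radial projection of a nonzero vector to the unit sphere. -/
noncomputable def toUSphere (y : E) (hy : y ≠ 0) : USphere E :=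
  ⟨‖y‖⁻¹ • y, by simp [norm_smul, inv_mul_cancel₀ (norm_ne_zero_iff.mpr hy)]⟩

theorem coe_toUSphere (y : E) (hy : y ≠ 0) : (toUSphere y hy : E) = ‖y‖⁻¹ • y := rfl

theorem radialExt_of_ne {F : Type*} [Zero F] (f : USphere E → F) {y : E} (hy : y ≠ 0) :
    radialExt f y = f (toUSphere y hy) := dif_neg hy

theorem toUSphere_coe (z : USphere E) : toUSphere (z : E) (coe_usphere_ne_zero z) = z :=
  Subtype.ext (by simp [coe_toUSphere])

theorem radialExt_coe {F : Type*} [Zero F] (f : USphere E → F) (z : USphere E) :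
    radialExt f (z : E) = f z := by
  rw [radialExt_of_ne f (coe_usphere_ne_zero z), toUSphere_coe]

theorem hasFDerivAt_norm_usphere (z : USphere E) :
    HasFDerivAt (fun y : E => ‖y‖) (innerSL ℝ (z : E)) (z : E) := by
  have h1 : DifferentiableAt ℝ (fun y : E => ‖y‖) (z : E) :=
    (contDiffAt_norm ℝ (coe_usphere_ne_zero z) (n := 1)).differentiableAt (by simp)
  have h2 := h1.hasFDerivAt.pow 2
  have h3 := (hasStrictFDerivAt_norm_sq (z : E)).hasFDerivAt
  have h4 := h2.unique h3
  convert! h1.hasFDerivAt using 1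
  ext v
  have h5 := DFunLike.congr_fun h4 v
  simp at h5
  simpa using h5.symm

theorem contDiffAt_normalize {y : E} (hy : y ≠ 0) :
    ContDiffAt ℝ ∞ (fun y : E => ‖y‖⁻¹ • y) y :=
  ((contDiffAt_norm ℝ hy).inv (norm_ne_zero_iff.2 hy)).smul contDiffAt_id

/-- The norm is stationary in directions tangent to the sphere, so normalizing changes nothing to
first order. -/
theorem fderiv_normalize_of_mem_tan (z : USphere E) {v : E} (hv : v ∈ Tan (z : E)) :
    fderiv ℝ (fun y : E => ‖y‖⁻¹ • y) (z : E) v = v := by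
  have h1 := (hasDerivAt_inv (by simp)).comp_hasFDerivAt (z : E) (hasFDerivAt_norm_usphere z)
  have h2 := h1.smul (hasFDerivAt_id (z : E))
  have h3 : ⟪(z : E), v⟫ = 0 := Submodule.mem_orthogonal_singleton_iff_inner_right.1 hv
  change fderiv ℝ ((Inv.inv ∘ fun y : E => ‖y‖) • id) (z : E) v = v
  rw [h2.fderiv]
  simp [h3]

theorem fderiv_comp_normalize {F : Type*} [NormedAddCommGroup F] [NormedSpace ℝ F] {G : E → F}
    (z : USphere E) (hG : DifferentiableAt ℝ G (z : E)) {v : E} (hv : v ∈ Tan (z : E)) :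
    fderiv ℝ (fun y : E => G (‖y‖⁻¹ • y)) (z : E) v = fderiv ℝ G (z : E) v := by
  have hz : ‖(z : E)‖⁻¹ • (z : E) = z := by simp
  have hN := ((contDiffAt_normalize (coe_usphere_ne_zero z)).differentiableAt (by simp)).hasFDerivAt
  have hG' : HasFDerivAt G (fderiv ℝ G (z : E)) (‖(z : E)‖⁻¹ • (z : E)) := by
    rw [hz]; exact hG.hasFDerivAt
  have h := (HasFDerivAt.comp (g := G) (f := fun y : E => ‖y‖⁻¹ • y) (z : E) hG' hN).fderiv
  change fderiv ℝ (G ∘ fun y : E => ‖y‖⁻¹ • y) (z : E) v = _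
  rw [h, ContinuousLinearMap.comp_apply, fderiv_normalize_of_mem_tan z hv]

variable [FiniteDimensional ℝ E]

theorem inner_gradient_eq_fderiv (f : E → ℝ) (x w : E) : ⟪gradient f x, w⟫ = fderiv ℝ f x w := by
  simp [gradient]

theorem inner_orthogonalProjectionOnto_coe (T : Submodule ℝ E) (x : E) (w : T) :
    ⟪T.orthogonalProjectionOnto x, w⟫ = ⟪x, (w : E)⟫ := by
  simp

variable {s : USphere E → ℝ} {z : USphere E}

theorem radialExt_sphereGradient_eventuallyEq (s : USphere E → ℝ) (z : USphere E) :
    radialExt (sphereGradient s) =ᶠ[nhds (z : E)]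
      fun y => gradient (radialExt s) (‖y‖⁻¹ • y) := by
  filter_upwards [eventually_ne_zero_nhds z] with y hy
  rw [radialExt_of_ne _ hy]
  rfl

theorem contDiffAt_gradient (hs : ContDiffAt ℝ ∞ (radialExt s) (z : E)) :
    ContDiffAt ℝ ∞ (gradient (radialExt s)) (z : E) :=
  (InnerProductSpace.toDual ℝ E).symm.toContinuousLinearEquiv.toContinuousLinearMap
    |>.contDiff.contDiffAt.comp (z : E) (hs.fderiv_right (by simp))

theorem contDiffAt_radialExt_sphereGradient (hs : ContDiffAt ℝ ∞ (radialExt s) (z : E)) :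
    ContDiffAt ℝ ∞ (radialExt (sphereGradient s)) (z : E) := by
  refine ContDiffAt.congr_of_eventuallyEq ?_ (radialExt_sphereGradient_eventuallyEq s z)
  have hz : ‖(z : E)‖⁻¹ • (z : E) = z := by simp
  refine ContDiffAt.comp (g := gradient (radialExt s)) (z : E) ?_
    (contDiffAt_normalize (coe_usphere_ne_zero z))
  rw [hz]
  exact contDiffAt_gradient hs

/-- Near z the extended gradient field is the Euclidean gradient composed with normalization, which
is invisible to tangential derivatives; the projection is invisible when pairing with a tangent
vector. -/
theorem inner_sphereHessian (hs : ContDiffAt ℝ ∞ (radialExt s) (z : E)) (v w : Tan (z : E)) :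
    ⟪sphereHessian s z v, w⟫ = fderiv ℝ (fderiv ℝ (radialExt s)) (z : E) v w := by
  have h1 : ⟪sphereHessian s z v, w⟫
      = ⟪fderiv ℝ (radialExt (sphereGradient s)) (z : E) (v : E), (w : E)⟫ := by
    rw [sphereHessian, covariantDeriv, ContinuousLinearMap.comp_apply,
      ContinuousLinearMap.comp_apply, inner_orthogonalProjectionOnto_coe, Submodule.subtypeL_apply]
  have h0 := (radialExt_sphereGradient_eventuallyEq s z).fderiv_eq (𝕜 := ℝ)
  have h5 := fderiv_comp_normalize z ((contDiffAt_gradient hs).differentiableAt (by simp)) v.2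
  rw [h1, h0, h5]
  have h2 : HasFDerivAt (fun y => ⟪gradient (radialExt s) y, (w : E)⟫) _ (z : E) :=
    ((contDiffAt_gradient hs).differentiableAt (by simp)).hasFDerivAt.inner ℝ
      (hasFDerivAt_const (w : E) (z : E))
  simp only [inner_gradient_eq_fderiv] at h2
  rw [← fderiv_fderiv_apply (hs.of_le two_le_infty), h2.fderiv]
  simp

theorem inner_radiiOfCurvature (hs : ContDiffAt ℝ ∞ (radialExt s) (z : E)) (v w : Tan (z : E)) :
    ⟪radiiOfCurvature s z v, w⟫
      = fderiv ℝ (fderiv ℝ (radialExt s)) (z : E) v w + s z * ⟪v, w⟫ := by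
  rw [← inner_sphereHessian hs]
  simp [radiiOfCurvature, inner_add_left, inner_smul_left]

theorem isSymmetric_radiiOfCurvature (hs : ContDiffAt ℝ ∞ (radialExt s) (z : E)) :
    (radiiOfCurvature s z : Tan (z : E) →ₗ[ℝ] Tan (z : E)).IsSymmetric := by
  intro v w
  rw [ContinuousLinearMap.coe_coe, real_inner_comm _ v, inner_radiiOfCurvature hs,
    inner_radiiOfCurvature hs, real_inner_comm w v]
  congr 1
  exact (hs.of_le two_le_infty).isSymmSndFDerivAt (by simp) _ _

/-- The inverse of the Gauss map, `z ↦ s z + ∇s`, written in terms of the support function `s`. -/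
noncomputable def inverseGauss (s : USphere E → ℝ) (z : USphere E) : E :=
  s z • (z : E) + sphereGradient s z

theorem radialExt_inverseGauss_eventuallyEq (s : USphere E → ℝ) (z : USphere E) :
    radialExt (inverseGauss s) =ᶠ[nhds (z : E)]
      fun y => radialExt s y • (‖y‖⁻¹ • y) + radialExt (sphereGradient s) y := by
  filter_upwards [eventually_ne_zero_nhds z] with y hy
  simp only [radialExt_of_ne _ hy]
  rfl

theorem contDiffAt_radialExt_inverseGauss (hs : ContDiffAt ℝ ∞ (radialExt s) (z : E)) :
    ContDiffAt ℝ ∞ (radialExt (inverseGauss s)) (z : E) :=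
  ((hs.smul (contDiffAt_normalize (coe_usphere_ne_zero z))).add
    (contDiffAt_radialExt_sphereGradient hs)).congr_of_eventuallyEq
      (radialExt_inverseGauss_eventuallyEq s z)

/-- Differentiating s z + ∇s along v gives s v + ds(v) z + D_v ∇s; the projection kills the multiple
of z and turns the last term into the covariant derivative. -/
theorem orthogonalProjection_fderiv_inverseGauss (hs : ContDiffAt ℝ ∞ (radialExt s) (z : E))
    (v : Tan (z : E)) :
    (Tan (z : E)).orthogonalProjectionOnto (fderiv ℝ (radialExt (inverseGauss s)) (z : E) v)
      = radiiOfCurvature s z v := by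
  have h1 := (hs.differentiableAt (by simp)).hasFDerivAt
  have h2 := ((contDiffAt_normalize (coe_usphere_ne_zero z)).differentiableAt
    (by simp)).hasFDerivAt
  have h3 := ((contDiffAt_radialExt_sphereGradient hs).differentiableAt (by simp)).hasFDerivAt
  have h4 : HasFDerivAt (fun y => radialExt s y • (‖y‖⁻¹ • y) + radialExt (sphereGradient s) y) _
    (z : E) := (h1.smul h2).add h3
  have hz : (Tan (z : E)).orthogonalProjectionOnto (z : E) = 0 :=
    Submodule.orthogonalProjectionOnto_orthogonalComplement_singleton_eq_zero _
  rw [(radialExt_inverseGauss_eventuallyEq s z).fderiv_eq, h4.fderiv]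
  simp only [add_apply, smul_apply,
    ContinuousLinearMap.smulRight_apply, fderiv_normalize_of_mem_tan z v.2, map_add, map_smul, hz,
    radialExt_coe, norm_coe_usphere, inv_one, one_smul, smul_zero, add_zero,
    Submodule.orthogonalProjectionOnto_mem_subspace_eq_self]
  simp [radiiOfCurvature, sphereHessian, covariantDeriv, add_comm]

end Sphere

/-! ### Convex bodies: support points and normals -/

section ConvexGeometry

variable {E : Type*} [NormedAddCommGroup E] [InnerProductSpace ℝ E] (K : ConvexBody E)

theorem inner_le_supportFunction (z : USphere E) {y : E} (hy : y ∈ (K : Set E)) :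
    ⟪(z : E), y⟫ ≤ supportFunction K z :=
  le_csSup (K.isCompact.image (by fun_prop)).bddAbove ⟨y, hy, rfl⟩

theorem exists_inner_eq_supportFunction (z : USphere E) :
    ∃ x ∈ (K : Set E), ⟪(z : E), x⟫ = supportFunction K z :=
  (K.isCompact.image (f := fun y : E => ⟪(z : E), y⟫) (by fun_prop)).sSup_mem (K.nonempty.image _)

variable {K}

theorem isOutwardUnitNormal_iff {x : E} (hx : x ∈ (K : Set E)) (z : USphere E) :
    IsOutwardUnitNormal (K : Set E) x z ↔ ⟪(z : E), x⟫ = supportFunction K z := by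
  constructor
  · rintro ⟨-, h⟩
    obtain ⟨y, hy, hyz⟩ := exists_inner_eq_supportFunction K z
    have h1 := h y hy
    rw [inner_sub_right] at h1
    exact le_antisymm (inner_le_supportFunction K z hx) (by linarith)
  · intro h
    refine ⟨norm_coe_usphere z, fun y hy => ?_⟩
    rw [inner_sub_right, h]
    linarith [inner_le_supportFunction K z hy]

theorem mem_frontier_of_inner_eq {x : E} (hx : x ∈ (K : Set E)) {z : USphere E}
    (h : ⟪(z : E), x⟫ = supportFunction K z) : x ∈ frontier (K : Set E) := by
  rw [K.isCompact.isClosed.frontier_eq]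
  refine ⟨hx, fun hint => ?_⟩
  have hcont : Filter.Tendsto (fun τ : ℝ => x + τ • (z : E)) (nhds 0) (nhds x) :=
    Continuous.tendsto' (by fun_prop) _ _ (by simp)
  have hev : ∀ᶠ τ in nhdsWithin (0 : ℝ) (Set.Ioi 0), x + τ • (z : E) ∈ (K : Set E) :=
    nhdsWithin_le_nhds (hcont.eventually (mem_interior_iff_mem_nhds.1 hint))
  obtain ⟨τ, hτ, hτ0⟩ := (hev.and self_mem_nhdsWithin).exists
  have h1 := inner_le_supportFunction K z hτ
  rw [inner_add_right, inner_smul_right, real_inner_self_eq_norm_sq, norm_coe_usphere, h] at h1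
  have : (0 : ℝ) < τ := hτ0
  linarith

variable [FiniteDimensional ℝ E]

/-- A convex body with positive support function contains the origin in its interior. -/
theorem zero_mem_interior {r : ℝ} (hr : 0 < r) (h : ∀ z, r ≤ supportFunction K z) :
    (0 : E) ∈ interior (K : Set E) := by
  rw [mem_interior_iff_mem_nhds]
  refine Filter.mem_of_superset (Metric.ball_mem_nhds 0 hr) fun y hy => ?_
  by_contra hyK
  -- If a point y with ‖y‖ < r were outside K, the support function in the separating direction
  -- would be less than ‖y‖, against the lower bound r.
  obtain ⟨f, u, hfu, huy⟩ := geometric_hahn_banach_closed_point K.convex K.isCompact.isClosed hyK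
  set w := (InnerProductSpace.toDual ℝ E).symm f with hw
  have hf : ∀ a, f a = ⟪w, a⟫ := fun a => by simp [hw]
  have hw0 : w ≠ 0 := by
    intro h0
    obtain ⟨a, ha⟩ := K.nonempty
    have := hfu a ha
    simp only [hf, h0, inner_zero_left] at this huy
    linarith
  have hwn : 0 < ‖w‖ := norm_pos_iff.2 hw0
  obtain ⟨x, hx, hxz⟩ := exists_inner_eq_supportFunction K (toUSphere w hw0)
  have h1 : r ≤ ⟪‖w‖⁻¹ • w, x⟫ := (h _).trans_eq hxz.symm
  rw [real_inner_smul_left, ← div_eq_inv_mul, le_div_iff₀ hwn] at h1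
  have h2 := (real_inner_le_norm w y)
  have h3 := hfu x hx
  rw [hf] at h3 huy
  have h4 : ‖y‖ < r := by simpa using hy
  nlinarith

theorem exists_isOutwardUnitNormal {x : E} (hint : (interior (K : Set E)).Nonempty)
    (hx : x ∈ frontier (K : Set E)) : ∃ z, IsOutwardUnitNormal (K : Set E) x z := by
  obtain ⟨f, hf0, hf⟩ := geometric_hahn_banach_of_nonempty_interior_point K.convex hx.2 hint
  set w := (InnerProductSpace.toDual ℝ E).symm f with hw
  have hfw : ∀ a, f a = ⟪w, a⟫ := fun a => by simp [hw]
  have hw0 : w ≠ 0 := by simpa [hw] using hf0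
  refine ⟨toUSphere w hw0, norm_coe_usphere _, fun y hy => ?_⟩
  have h1 := hf y hy
  rw [hfw, hfw] at h1
  rw [coe_toUSphere, real_inner_smul_left, inner_sub_right]
  exact mul_nonpos_of_nonneg_of_nonpos (by positivity) (by linarith)

section Smooth

variable (hs : ∀ z : USphere E, ContDiffAt ℝ ∞ (radialExt (supportFunction K)) (z : E))

include hs

/-- A boundary point with outward normal `z` is the gradient at `z` of the support function. -/
theorem eq_inverseGauss {x : E} (hx : x ∈ (K : Set E)) {z : USphere E}
    (h : ⟪(z : E), x⟫ = supportFunction K z) : x = inverseGauss (supportFunction K) z := by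
  set s := supportFunction K
  -- The one-homogeneous support function dominates ⟨x, y⟩, with equality at z; the first order
  -- condition there is the formula for x.
  have hmin : IsLocalMin (fun y => ‖y‖ * radialExt s y - ⟪x, y⟫) (z : E) := by
    filter_upwards [eventually_ne_zero_nhds z] with y hy
    have h1 := inner_le_supportFunction K (toUSphere y hy) hx
    rw [coe_toUSphere, real_inner_smul_left, ← div_eq_inv_mul,
      div_le_iff₀ (norm_pos_iff.2 hy)] at h1
    rw [radialExt_coe, norm_coe_usphere, one_mul, real_inner_comm, h, sub_self,
      radialExt_of_ne _ hy, real_inner_comm]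
    linarith
  have hd := ((hasFDerivAt_norm_usphere z).mul
    ((hs z).differentiableAt (by simp)).hasFDerivAt).sub (innerSL ℝ x).hasFDerivAt
  have h0 := hmin.hasFDerivAt_eq_zero hd
  refine ext_inner_right ℝ fun w => ?_
  have h1 := DFunLike.congr_fun h0 w
  rw [norm_coe_usphere, radialExt_coe] at h1
  simp only [sub_apply, add_apply, smul_apply, innerSL_apply_apply, smul_eq_mul, one_mul,
    zero_apply] at h1
  rw [inverseGauss, inner_add_left, real_inner_smul_left, sphereGradient, inner_gradient_eq_fderiv]
  linarith

theorem exists_eq_inverseGauss {x : E} (hint : (interior (K : Set E)).Nonempty)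
    (hx : x ∈ frontier (K : Set E)) : ∃ z, x = inverseGauss (supportFunction K) z := by
  obtain ⟨z, hz⟩ := exists_isOutwardUnitNormal hint hx
  have hxK := K.isCompact.isClosed.frontier_subset hx
  exact ⟨⟨z, by simpa using hz.1⟩, eq_inverseGauss hs hxK
    ((isOutwardUnitNormal_iff hxK ⟨z, by simpa using hz.1⟩).1 hz)⟩

theorem inverseGauss_mem (z : USphere E) : inverseGauss (supportFunction K) z ∈ (K : Set E) := by
  obtain ⟨x, hx, hxz⟩ := exists_inner_eq_supportFunction K z
  rwa [← eq_inverseGauss hs hx hxz]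

theorem inner_inverseGauss (z : USphere E) :
    ⟪(z : E), inverseGauss (supportFunction K) z⟫ = supportFunction K z := by
  obtain ⟨x, hx, hxz⟩ := exists_inner_eq_supportFunction K z
  rwa [← eq_inverseGauss hs hx hxz]

theorem inverseGauss_mem_frontier (z : USphere E) :
    inverseGauss (supportFunction K) z ∈ frontier (K : Set E) :=
  mem_frontier_of_inner_eq (inverseGauss_mem hs z) (inner_inverseGauss hs z)

/-- All values of X lie in K, so ⟨z, X⟩ is maximal at z, where it equals the support function; its
derivative vanishes there. -/
theorem inner_fderiv_inverseGauss (z : USphere E) (w : E) :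
    ⟪(z : E), fderiv ℝ (radialExt (inverseGauss (supportFunction K))) (z : E) w⟫ = 0 := by
  have hX := ((contDiffAt_radialExt_inverseGauss (hs z)).differentiableAt (by simp)).hasFDerivAt
  have hmax : IsLocalMax (fun y => ⟪(z : E), radialExt (inverseGauss (supportFunction K)) y⟫)
      (z : E) := by
    filter_upwards [eventually_ne_zero_nhds z] with y hy
    rw [radialExt_coe, inner_inverseGauss hs, radialExt_of_ne _ hy]
    exact inner_le_supportFunction K z (inverseGauss_mem hs _)
  have h0 := hmax.hasFDerivAt_eq_zero ((hasFDerivAt_const (z : E) (z : E)).inner ℝ hX)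
  simpa using DFunLike.congr_fun h0 w

theorem fderiv_inverseGauss {z : USphere E} (v : Tan (z : E)) :
    fderiv ℝ (radialExt (inverseGauss (supportFunction K))) (z : E) v
      = radiiOfCurvature (supportFunction K) z v := by
  have hmem : fderiv ℝ (radialExt (inverseGauss (supportFunction K))) (z : E) v ∈ Tan (z : E) :=
    Submodule.mem_orthogonal_singleton_iff_inner_right.2 (inner_fderiv_inverseGauss hs z v)
  rw [← orthogonalProjection_fderiv_inverseGauss (hs z) v]
  exact (congrArg Subtype.val
    (Submodule.orthogonalProjectionOnto_mem_subspace_eq_self (K := Tan (z : E)) ⟨_, hmem⟩)).symm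

variable (hpos : ∀ z : USphere E, ∀ v : Tan (z : E), v ≠ 0 →
    0 < ⟪radiiOfCurvature (supportFunction K) z v, v⟫)
  (hs0 : ∀ z, 0 < supportFunction K z)

include hpos hs0

/-- The outward normals at x form a convex cone, so if z and z' are both normals, X equals x along
an arc from z towards z'. Its derivative in the direction v, the part of z' tangent at z, is A v,
and positive definiteness forces v = 0. Then z' = ±z, and positivity of the support function fixes
the sign. -/
theorem eq_of_inner_eq {x : E} (hx : x ∈ (K : Set E)) {z z' : USphere E}
    (h : ⟪(z : E), x⟫ = supportFunction K z) (h' : ⟪(z' : E), x⟫ = supportFunction K z') :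
    z' = z := by
  set c : ℝ := ⟪(z : E), (z' : E)⟫ with hc
  set v : E := z' - c • z with hv
  have hvt : v ∈ Tan (z : E) := by
    rw [Submodule.mem_orthogonal_singleton_iff_inner_right, hv, inner_sub_right, inner_smul_right,
      real_inner_self_eq_norm_sq, norm_coe_usphere, ← hc]
    ring
  have hv0 : v = 0 := by
    by_contra hne
    have hline : HasDerivAt (fun τ : ℝ => (z : E) + τ • v) v 0 := by
      simpa using ((hasDerivAt_id (0 : ℝ)).smul_const v).const_add (z : E)
    have hX : HasFDerivAt (radialExt (inverseGauss (supportFunction K)))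
        (fderiv ℝ (radialExt (inverseGauss (supportFunction K))) (z : E))
        ((z : E) + (0 : ℝ) • v) := by
      rw [zero_smul, add_zero]
      exact ((contDiffAt_radialExt_inverseGauss (hs z)).differentiableAt (by simp)).hasFDerivAt
    -- One-sided derivatives are needed: the combination of z and z' has nonnegative coefficients
    -- only for τ ≥ 0.
    have hd := (hX.comp_hasDerivAt (0 : ℝ) hline).hasDerivWithinAt (s := Set.Ici 0)
    have hev : ∀ᶠ τ in nhdsWithin (0 : ℝ) (Set.Ici 0),
        (radialExt (inverseGauss (supportFunction K)) ∘ fun τ : ℝ => (z : E) + τ • v) τ = x := by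
      have hcont := hline.continuousAt
      have h1 : ∀ᶠ τ in nhds (0 : ℝ), (z : E) + τ • v ≠ 0 :=
        hcont.eventually (by simpa using eventually_ne_zero_nhds z)
      have h2 : ∀ᶠ τ in nhds (0 : ℝ), 0 < 1 - τ * c :=
        (Continuous.tendsto' (by fun_prop) 0 (1 : ℝ) (by simp)).eventually_const_lt one_pos
      filter_upwards [nhdsWithin_le_nhds h1, nhdsWithin_le_nhds h2, self_mem_nhdsWithin]
        with τ hy hτc hτ
      have hτ' : 0 ≤ τ := hτ
      have hcomb : (z : E) + τ • v = (1 - τ * c) • (z : E) + τ • (z' : E) := by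
        rw [hv]; module
      rw [Function.comp_apply, radialExt_of_ne _ hy]
      refine (eq_inverseGauss hs hx (le_antisymm (inner_le_supportFunction K _ hx) ?_)).symm
      obtain ⟨y, hyK, hye⟩ := exists_inner_eq_supportFunction K (toUSphere _ hy)
      rw [← hye, coe_toUSphere, real_inner_smul_left, real_inner_smul_left]
      refine mul_le_mul_of_nonneg_left ?_ (by positivity)
      rw [hcomb, inner_add_left, inner_add_left]
      simp only [real_inner_smul_left]
      have h3 := inner_le_supportFunction K z hyK
      have h4 := inner_le_supportFunction K z' hyK
      rw [← h] at h3
      rw [← h'] at h4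
      gcongr
    have hx0 : (radialExt (inverseGauss (supportFunction K)) ∘
        fun τ : ℝ => (z : E) + τ • v) 0 = x := hev.self_of_nhdsWithin (by simp)
    have hd2 := (hasDerivWithinAt_const (0 : ℝ) (Set.Ici 0) x).congr_of_eventuallyEq hev hx0
    have hd3 := (uniqueDiffWithinAt_Ici (0 : ℝ)).eq_deriv _ hd hd2
    rw [fderiv_inverseGauss hs ⟨v, hvt⟩] at hd3
    have := hpos z ⟨v, hvt⟩ (by simpa using hne)
    have hA : radiiOfCurvature (supportFunction K) z ⟨v, hvt⟩ = 0 := Subtype.ext hd3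
    rw [hA] at this
    simp at this
  have hz' : (z' : E) = c • (z : E) := sub_eq_zero.1 hv0
  have hcn : |c| = 1 := by
    have := congrArg norm hz'
    rw [norm_smul, norm_coe_usphere, norm_coe_usphere, mul_one] at this
    simpa using this.symm
  have hc0 : 0 < c := by
    have h1 := hs0 z'
    rw [← h', hz', real_inner_smul_left, h] at h1
    exact pos_of_mul_pos_left h1 (hs0 z).le
  rw [abs_of_pos hc0] at hcn
  exact Subtype.ext (by rw [hz', hcn, one_smul])

theorem gaussMap_inverseGauss (z : USphere E) :
    gaussMap K (inverseGauss (supportFunction K) z) = z := by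
  have hmem := inverseGauss_mem hs z
  have hz := (isOutwardUnitNormal_iff hmem z).2 (inner_inverseGauss hs z)
  have hg : IsOutwardUnitNormal (K : Set E) _ (gaussMap K _) := Classical.epsilon_spec ⟨_, hz⟩
  have h1 := (isOutwardUnitNormal_iff hmem ⟨gaussMap K _, by simpa using hg.1⟩).1 hg
  exact congrArg Subtype.val (eq_of_inner_eq hs hpos hs0 hmem (inner_inverseGauss hs z) h1)

end Smooth

end ConvexGeometry

/-! ### The Gauss curvature as the reciprocal of `detRadii` -/

section GaussCurvature

variable {E : Type*} [NormedAddCommGroup E] [InnerProductSpace ℝ E] [FiniteDimensional ℝ E]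
  {K : ConvexBody E}
  (hs : ∀ z : USphere E, ContDiffAt ℝ ∞ (radialExt (supportFunction K)) (z : E))

include hs

theorem continuous_inverseGauss : Continuous (inverseGauss (supportFunction K)) := by
  have h : inverseGauss (supportFunction K)
      = fun z : USphere E => radialExt (inverseGauss (supportFunction K)) (z : E) :=
    funext fun z => (radialExt_coe _ z).symm
  rw [h, continuous_iff_continuousAt]
  exact fun z => (contDiffAt_radialExt_inverseGauss (hs z)).continuousAt.comp
    continuous_subtype_val.continuousAt

variable (hpos : ∀ z : USphere E, ∀ v : Tan (z : E), v ≠ 0 →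
    0 < ⟪radiiOfCurvature (supportFunction K) z v, v⟫)
  (hs0 : ∀ z, 0 < supportFunction K z) (hint : (interior (K : Set E)).Nonempty)

include hpos hs0 hint

/-- A continuous injection of the compact sphere onto the boundary is an embedding, so statements
near a boundary point can be checked near its normal. -/
theorem nhdsWithin_frontier_inverseGauss (z : USphere E) :
    nhdsWithin (inverseGauss (supportFunction K) z) (frontier (K : Set E))
      = Filter.map (inverseGauss (supportFunction K)) (nhds z) := by
  have hinj : Function.Injective (inverseGauss (supportFunction K)) := fun z z' h =>
    Subtype.ext (by
      rw [← gaussMap_inverseGauss hs hpos hs0 z, h, gaussMap_inverseGauss hs hpos hs0 z'])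
  have hrange : frontier (K : Set E) = Set.range (inverseGauss (supportFunction K)) := by
    ext x
    constructor
    · intro hx
      obtain ⟨z, rfl⟩ := exists_eq_inverseGauss hs hint hx
      exact ⟨z, rfl⟩
    · rintro ⟨z, rfl⟩
      exact inverseGauss_mem_frontier hs z
  rw [hrange]
  exact (((continuous_inverseGauss hs).isClosedEmbedding hinj).isEmbedding.map_nhds_eq z).symm

/-- The Gauss map of a smooth strictly convex body is differentiable along the boundary, by the
inverse function theorem. -/
theorem differentiableWithinAt_gaussMap (z : USphere E) :
    DifferentiableWithinAt ℝ (gaussMap K) (frontier (K : Set E))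
      (inverseGauss (supportFunction K) z) := by
  set X := inverseGauss (supportFunction K) with hX
  -- The extension of degree one replaces that of degree zero, whose derivative kills z. Here z goes
  -- to X z, which is transversal to the tangent plane because ⟨z, X z⟩ = s z > 0.
  set Y : E → E := fun y => ‖y‖ • radialExt X y with hY
  set D : E →L[ℝ] E := fderiv ℝ Y (z : E) with hD
  have hYs : ContDiffAt ℝ ∞ Y (z : E) :=
    (contDiffAt_norm ℝ (coe_usphere_ne_zero z)).smul (contDiffAt_radialExt_inverseGauss (hs z))
  have hYz : ∀ w : USphere E, Y (w : E) = X w := fun w => by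
    simp only [hY, norm_coe_usphere, one_smul, radialExt_coe]
  have hDw : ∀ w, D w = fderiv ℝ (radialExt X) (z : E) w + ⟪(z : E), w⟫ • X z := by
    intro w
    have h1 := ((contDiffAt_radialExt_inverseGauss (hs z)).differentiableAt (by simp)).hasFDerivAt
    have h2 : HasFDerivAt Y _ (z : E) := (hasFDerivAt_norm_usphere z).smul h1
    rw [hD, h2.fderiv]
    simp [radialExt_coe, hX]
  have hker : ∀ w, D w = 0 → w = 0 := by
    intro w hw
    rw [hDw] at hw
    have h1 := congrArg (fun y => ⟪(z : E), y⟫) hw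
    simp only [inner_add_right, inner_fderiv_inverseGauss hs, hX, real_inner_smul_right,
      inner_inverseGauss hs, inner_zero_right, zero_add] at h1
    have h2 : ⟪(z : E), w⟫ = 0 := (mul_eq_zero.1 h1).resolve_right (hs0 z).ne'
    have hwt : w ∈ Tan (z : E) := Submodule.mem_orthogonal_singleton_iff_inner_right.2 h2
    rw [h2, zero_smul, add_zero, fderiv_inverseGauss hs ⟨w, hwt⟩] at hw
    by_contra hne
    have h3 := hpos z ⟨w, hwt⟩ (by simpa using hne)
    have hA : radiiOfCurvature (supportFunction K) z ⟨w, hwt⟩ = 0 := Subtype.ext hw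
    rw [hA] at h3
    simp at h3
  let e : E ≃L[ℝ] E := (LinearEquiv.ofInjectiveEndo (D : E →ₗ[ℝ] E)
    ((injective_iff_map_eq_zero (D : E →ₗ[ℝ] E)).2 hker)).toContinuousLinearEquiv
  have heD : (e : E →L[ℝ] E) = D := by ext w; rfl
  have hstrict : HasStrictFDerivAt Y (e : E →L[ℝ] E) (z : E) := by
    rw [heD]; exact hYs.hasStrictFDerivAt (by simp)
  have hg := hstrict.to_localInverse.hasFDerivAt
  rw [hYz] at hg
  refine hg.differentiableAt.differentiableWithinAt.congr_of_eventuallyEq ?_ ?_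
  · rw [Filter.EventuallyEq, nhdsWithin_frontier_inverseGauss hs hpos hs0 hint,
      Filter.eventually_map]
    have h1 : ∀ᶠ w : USphere E in nhds z, hstrict.localInverse Y e (z : E) (Y (w : E)) = w :=
      continuous_subtype_val.continuousAt.eventually hstrict.eventually_left_inverse
    filter_upwards [h1] with w hw
    rw [gaussMap_inverseGauss hs hpos hs0, ← hX, ← hYz, hw]
  · rw [hX, gaussMap_inverseGauss hs hpos hs0, ← hX, ← hYz]
    exact hstrict.localInverse_apply_image.symm

/-- The Gauss curvature is the reciprocal of the product of the radii of curvature. -/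
theorem gaussCurvature_mul_detRadii (z : USphere E) :
    gaussCurvature K (inverseGauss (supportFunction K) z) * detRadii (supportFunction K) z = 1 := by
  set X := inverseGauss (supportFunction K) with hX
  set L := fderivWithin ℝ (gaussMap K) (frontier (K : Set E)) (X z) with hL
  have hν : HasFDerivWithinAt (gaussMap K) L (frontier (K : Set E)) (X z) :=
    (differentiableWithinAt_gaussMap hs hpos hs0 hint z).hasFDerivWithinAt
  -- The normal is generalized to y because the tangent space, a type, depends on it.
  have hcurv : ∀ y, y = gaussMap K (X z) → gaussCurvature K (X z)
      = LinearMap.det (((Tan y).orthogonalProjectionOnto ∘L L ∘L (Tan y).subtypeL :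
        Tan y →L[ℝ] Tan y) : Tan y →ₗ[ℝ] Tan y) := by
    rintro _ rfl; rfl
  rw [hcurv z (gaussMap_inverseGauss hs hpos hs0 z).symm, detRadii, ← LinearMap.det_comp]
  -- The chain rule for ν ∘ X = id along curves in the boundary determines L on the range of A,
  -- whichever derivative within the frontier was chosen.
  have key : ∀ v : Tan (z : E), L (radiiOfCurvature (supportFunction K) z v) = v := by
    intro v
    have hline : HasDerivAt (fun τ : ℝ => (z : E) + τ • (v : E)) v 0 := by
      simpa using ((hasDerivAt_id (0 : ℝ)).smul_const (v : E)).const_add (z : E)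
    have hz0 : (z : E) + (0 : ℝ) • (v : E) = z := by simp
    have hev : ∀ᶠ τ in nhds (0 : ℝ), (z : E) + τ • (v : E) ≠ 0 :=
      hline.continuousAt.eventually (by simpa using eventually_ne_zero_nhds z)
    have h1 : HasFDerivAt (radialExt X) (fderiv ℝ (radialExt X) (z : E))
        ((z : E) + (0 : ℝ) • (v : E)) := by
      rw [hz0]
      exact ((contDiffAt_radialExt_inverseGauss (hs z)).differentiableAt (by simp)).hasFDerivAt
    have h2 : HasDerivAt (fun τ : ℝ => radialExt X ((z : E) + τ • (v : E)))
        (radiiOfCurvature (supportFunction K) z v : E) 0 := by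
      rw [← fderiv_inverseGauss hs v]
      exact h1.comp_hasDerivAt (0 : ℝ) hline
    have h3 : HasDerivAt (gaussMap K ∘ fun τ : ℝ => radialExt X ((z : E) + τ • (v : E)))
        (L (radiiOfCurvature (supportFunction K) z v)) 0 := by
      refine HasFDerivWithinAt.comp_hasDerivAt (0 : ℝ) (t := frontier (K : Set E)) ?_ h2 ?_
      · rw [hz0, radialExt_coe]; exact hν
      · filter_upwards [hev] with τ hτ
        rw [radialExt_of_ne _ hτ]
        exact inverseGauss_mem_frontier hs _
    have h4 : HasFDerivAt (fun y : E => ‖y‖⁻¹ • y) (fderiv ℝ (fun y : E => ‖y‖⁻¹ • y) (z : E))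
        ((z : E) + (0 : ℝ) • (v : E)) := by
      rw [hz0]
      exact ((contDiffAt_normalize (coe_usphere_ne_zero z)).differentiableAt
        (by simp)).hasFDerivAt
    have h5 := h4.comp_hasDerivAt (0 : ℝ) hline
    rw [fderiv_normalize_of_mem_tan z v.2] at h5
    refine h3.unique (h5.congr_of_eventuallyEq ?_)
    filter_upwards [hev] with τ hτ
    rw [Function.comp_apply, radialExt_of_ne _ hτ, hX, gaussMap_inverseGauss hs hpos hs0]
    rfl
  have hid : (((Tan (z : E)).orthogonalProjectionOnto ∘L L ∘L (Tan (z : E)).subtypeL :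
        Tan (z : E) →L[ℝ] Tan (z : E)) : Tan (z : E) →ₗ[ℝ] Tan (z : E)) ∘ₗ
      (radiiOfCurvature (supportFunction K) z : Tan (z : E) →ₗ[ℝ] Tan (z : E))
      = LinearMap.id := by
    refine LinearMap.ext fun v => ?_
    rw [LinearMap.comp_apply, ContinuousLinearMap.coe_coe, ContinuousLinearMap.coe_coe,
      ContinuousLinearMap.comp_apply, ContinuousLinearMap.comp_apply, Submodule.subtypeL_apply,
      key, Submodule.orthogonalProjectionOnto_mem_subspace_eq_self, LinearMap.id_apply]
  rw [hid, LinearMap.det_id]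

end GaussCurvature

/-! ### Regularity of the flow and evolution of `detRadii` -/

section Flow

/-- A function which is smooth on the product of the unit sphere with a set `I` of times has a
smooth radial extension. -/
theorem contDiffOn_radialExt {m : ℕ} {I : Set ℝ}
    {f : USphere (EuclideanSpace ℝ (Fin (m + 1))) × ℝ → ℝ}
    (hf : ContMDiffOn ((𝓡 m).prod 𝓘(ℝ, ℝ)) 𝓘(ℝ, ℝ) ∞ f (Set.univ ×ˢ I)) :
    ContDiffOn ℝ ∞ (fun q : EuclideanSpace ℝ (Fin (m + 1)) × ℝ =>
      radialExt (fun z => f (z, q.2)) q.1) ({0}ᶜ ×ˢ I) := by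
  rintro ⟨y₀, t⟩ ⟨hy₀ : y₀ ≠ 0, ht⟩
  classical
  -- The value at the origin is an arbitrary point of the sphere, there only to make the projection
  -- total.
  let ρ : EuclideanSpace ℝ (Fin (m + 1)) → USphere (EuclideanSpace ℝ (Fin (m + 1))) :=
    fun y => if hy : y = 0 then toUSphere y₀ hy₀ else toUSphere y hy
  let U : TopologicalSpace.Opens (EuclideanSpace ℝ (Fin (m + 1))) := ⟨{0}ᶜ, isOpen_ne⟩
  have hρU : ContMDiff 𝓘(ℝ, EuclideanSpace ℝ (Fin (m + 1))) (𝓡 m) ∞ (fun y : U => ρ y) := by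
    have h1 : ContMDiff 𝓘(ℝ, EuclideanSpace ℝ (Fin (m + 1)))
        𝓘(ℝ, EuclideanSpace ℝ (Fin (m + 1))) ∞
        (fun y : U => ‖(y : EuclideanSpace ℝ (Fin (m + 1)))‖⁻¹ •
          (y : EuclideanSpace ℝ (Fin (m + 1)))) := fun y =>
      contMDiffAt_subtype_iff.2 (contDiffAt_normalize y.2).contMDiffAt
    have := Fact.mk (@finrank_euclideanSpace_fin ℝ _ (m + 1))
    have h2 := h1.codRestrict_sphere (n := m) (fun y => (toUSphere _ y.2).2)
    convert! h2 using 1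
    ext1 y
    exact dif_neg y.2
  have hρ : ContMDiffAt 𝓘(ℝ, EuclideanSpace ℝ (Fin (m + 1))) (𝓡 m) ∞ ρ y₀ :=
    contMDiffAt_subtype_iff.1 (hρU ⟨y₀, hy₀⟩)
  have h1 : ContMDiffWithinAt 𝓘(ℝ, EuclideanSpace ℝ (Fin (m + 1)) × ℝ)
      ((𝓡 m).prod 𝓘(ℝ, ℝ)) ∞ (fun q : EuclideanSpace ℝ (Fin (m + 1)) × ℝ => (ρ q.1, q.2))
      ({0}ᶜ ×ˢ I) (y₀, t) :=
    ((ContMDiffAt.comp (y₀, t) hρ contDiff_fst.contMDiff.contMDiffAt).prodMk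
      contDiff_snd.contMDiff.contMDiffAt).contMDiffWithinAt
  have h2 := (hf (ρ y₀, t) ⟨Set.mem_univ _, ht⟩).comp (y₀, t) h1
    (fun q hq => Set.mk_mem_prod (Set.mem_univ _) hq.2)
  refine h2.contDiffWithinAt.congr (fun q hq => ?_) ?_
  · have hq1 : q.1 ≠ 0 := hq.1
    simp only [Function.comp_apply, ρ, dif_neg hq1, radialExt_of_ne _ hq1]
  · simp only [Function.comp_apply, ρ, dif_neg hy₀, radialExt_of_ne _ hy₀]

variable {m : ℕ} {p t₀ : ℝ} {Φ : USphere (EuclideanSpace ℝ (Fin (m + 1))) → ℝ}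
  {K : ℝ → ConvexBody (EuclideanSpace ℝ (Fin (m + 1)))}

namespace IsSmoothStrictlyConvexSolution

variable (h : IsSmoothStrictlyConvexSolution m p t₀ Φ K)

include h

theorem contDiffOn : ContDiffOn ℝ ∞ (fun q : EuclideanSpace ℝ (Fin (m + 1)) × ℝ =>
    radialExt (supportFunction (K q.2)) q.1) ({0}ᶜ ×ˢ Set.Icc 0 t₀) :=
  contDiffOn_radialExt h.smooth

theorem contDiffAt_slice {t : ℝ} (ht : t ∈ Set.Icc 0 t₀)
    (z : USphere (EuclideanSpace ℝ (Fin (m + 1)))) :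
    ContDiffAt ℝ ∞ (radialExt (supportFunction (K t))) (z : EuclideanSpace ℝ (Fin (m + 1))) := by
  have h1 : ContDiffOn ℝ ∞ (radialExt (supportFunction (K t))) {0}ᶜ :=
    h.contDiffOn.comp (f := fun y => (y, t)) (contDiff_id.prodMk contDiff_const).contDiffOn
      (fun y hy => ⟨hy, ht⟩)
  exact h1.contDiffAt (isOpen_ne.mem_nhds (coe_usphere_ne_zero z))

theorem contDiffOn_Ioo : ContDiffOn ℝ ∞ (fun q : EuclideanSpace ℝ (Fin (m + 1)) × ℝ =>
    radialExt (supportFunction (K q.2)) q.1) ({0}ᶜ ×ˢ Set.Ioo 0 t₀) :=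
  h.contDiffOn.mono (Set.prod_mono le_rfl Set.Ioo_subset_Icc_self)

theorem detRadii_pos {t : ℝ} (ht : t ∈ Set.Icc 0 t₀)
    (z : USphere (EuclideanSpace ℝ (Fin (m + 1)))) : 0 < detRadii (supportFunction (K t)) z :=
  det_pos_of_posDef (isSymmetric_radiiOfCurvature (h.contDiffAt_slice ht z))
    (h.strictlyConvex t ht z)

theorem fderiv_time {t : ℝ} (ht : t ∈ Set.Ioo 0 t₀) {y : EuclideanSpace ℝ (Fin (m + 1))}
    (hy : y ≠ 0) :
    fderiv ℝ (fun q : EuclideanSpace ℝ (Fin (m + 1)) × ℝ =>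
        radialExt (supportFunction (K q.2)) q.1) (y, t) (0, 1)
      = radialExt (fun z => Φ z * detRadii (supportFunction (K t)) z ^ (p / m)) y := by
  have hO : IsOpen (({0}ᶜ : Set (EuclideanSpace ℝ (Fin (m + 1)))) ×ˢ Set.Ioo 0 t₀) :=
    isOpen_ne.prod isOpen_Ioo
  have h1 := ((h.contDiffOn_Ioo.contDiffAt (hO.mem_nhds
    (show (y, t) ∈ _ from ⟨hy, ht⟩))).differentiableAt (by simp)).hasFDerivAt
  have h2 : HasDerivAt (fun τ : ℝ => (y, τ)) (0, 1) t :=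
    (hasDerivAt_const t y).prodMk (hasDerivAt_id t)
  have h3 := h1.comp_hasDerivAt t h2
  have h4 := (h.evolution t (Set.Ioo_subset_Icc_self ht) (toUSphere y hy)).hasDerivAt
    (Icc_mem_nhds ht.1 ht.2)
  rw [radialExt_of_ne _ hy]
  refine h3.unique (h4.congr_of_eventuallyEq (Filter.Eventually.of_forall fun τ => ?_))
  exact radialExt_of_ne _ hy

/-- At a spatial minimum of the speed, `∂_t S ≥ m (∂_t s) S^{1 - 1/m}`. -/
theorem exists_hasDerivAt_detRadii_ge (hm : 1 ≤ m) (hΦ : ∀ z, 0 < Φ z) {t : ℝ}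
    (ht : t ∈ Set.Ioo 0 t₀) {z : USphere (EuclideanSpace ℝ (Fin (m + 1)))}
    (hmin : ∀ w, Φ z * detRadii (supportFunction (K t)) z ^ (p / m)
      ≤ Φ w * detRadii (supportFunction (K t)) w ^ (p / m)) :
    ∃ d, HasDerivAt (fun τ => detRadii (supportFunction (K τ)) z) d t ∧
      m * (Φ z * detRadii (supportFunction (K t)) z ^ (p / m))
        * detRadii (supportFunction (K t)) z
        * detRadii (supportFunction (K t)) z ^ (-(1 / (m : ℝ))) ≤ d := by
  have hO : IsOpen (({0}ᶜ : Set (EuclideanSpace ℝ (Fin (m + 1)))) ×ˢ Set.Ioo 0 t₀) :=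
    isOpen_ne.prod isOpen_Ioo
  have hzt : ((z : EuclideanSpace ℝ (Fin (m + 1))), t) ∈
      (({0}ᶜ : Set (EuclideanSpace ℝ (Fin (m + 1)))) ×ˢ Set.Ioo 0 t₀) :=
    ⟨coe_usphere_ne_zero z, ht⟩
  have htI := Set.Ioo_subset_Icc_self ht
  set ψ : USphere (EuclideanSpace ℝ (Fin (m + 1))) → ℝ :=
    fun w => Φ w * detRadii (supportFunction (K t)) w ^ (p / m) with hψ
  have hev : (fun y => fderiv ℝ (fun q : EuclideanSpace ℝ (Fin (m + 1)) × ℝ =>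
      radialExt (supportFunction (K q.2)) q.1) (y, t) (0, 1))
      =ᶠ[nhds (z : EuclideanSpace ℝ (Fin (m + 1)))] radialExt ψ := by
    filter_upwards [eventually_ne_zero_nhds z] with y hy
    exact h.fderiv_time ht hy
  have hψs : ContDiffAt ℝ 2 (radialExt ψ) (z : EuclideanSpace ℝ (Fin (m + 1))) := by
    refine ContDiffAt.congr_of_eventuallyEq ?_ hev.symm
    have h1 := (contDiffOn_fderiv_apply hO h.contDiffOn_Ioo (0, 1)).contDiffAt (hO.mem_nhds hzt)
    exact ((h1.comp (z : EuclideanSpace ℝ (Fin (m + 1)))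
      (contDiff_id.prodMk contDiff_const).contDiffAt).of_le two_le_infty :)
  have hψmin : IsLocalMin (radialExt ψ) (z : EuclideanSpace ℝ (Fin (m + 1))) := by
    filter_upwards [eventually_ne_zero_nhds z] with y hy
    rw [radialExt_coe, radialExt_of_ne _ hy]
    exact hmin _
  have hdim : Module.finrank ℝ (Tan (z : EuclideanSpace ℝ (Fin (m + 1)))) = m := by
    have : Fact (Module.finrank ℝ (EuclideanSpace ℝ (Fin (m + 1))) = m + 1) := ⟨by simp⟩
    exact Submodule.finrank_orthogonal_span_singleton (coe_usphere_ne_zero z)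
  have hψ0 : 0 ≤ ψ z := (mul_pos (hΦ z) (Real.rpow_pos_of_pos (h.detRadii_pos htI z) _)).le
  -- The time derivative of A is ∇²ψ + ψ g, with ψ the speed, and ∇²ψ ≥ 0 at the spatial minimum.
  refine exists_hasDerivAt_det_ge hm hdim hψ0
    (A := fun τ => radiiOfCurvature (supportFunction (K τ)) z)
    (B := fun v w => fderiv ℝ (fderiv ℝ (radialExt ψ)) (z : EuclideanSpace ℝ (Fin (m + 1))) v w
      + ψ z * ⟪v, w⟫) (fun v w => ?_)
    (isSymmetric_radiiOfCurvature (h.contDiffAt_slice htI z)) (h.strictlyConvex t htI z)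
    (fun v => ?_)
  · have h1 := hasDerivAt_fderiv_fderiv hO h.contDiffOn_Ioo hzt v w
    rw [hev.fderiv.fderiv_eq] at h1
    have h2 : HasDerivAt (fun τ => supportFunction (K τ) z) (ψ z) t :=
      (h.evolution t htI z).hasDerivAt (Icc_mem_nhds ht.1 ht.2)
    refine (h1.add (h2.mul_const ⟪v, w⟫)).congr_of_eventuallyEq ?_
    filter_upwards [Icc_mem_nhds ht.1 ht.2] with τ hτ
    exact inner_radiiOfCurvature (h.contDiffAt_slice hτ z) v w
  · have := fderiv_fderiv_nonneg_of_isLocalMin hψs hψmin v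
    linarith

/-- The speed is the time derivative of the smooth support function, so the determinant need not be
analysed. -/
theorem continuousOn_speed : ContinuousOn
    (fun q : USphere (EuclideanSpace ℝ (Fin (m + 1))) × ℝ =>
      Φ q.1 * detRadii (supportFunction (K q.2)) q.1 ^ (p / m)) (Set.univ ×ˢ Set.Ioo 0 t₀) := by
  have hO : IsOpen (({0}ᶜ : Set (EuclideanSpace ℝ (Fin (m + 1)))) ×ˢ Set.Ioo 0 t₀) :=
    isOpen_ne.prod isOpen_Ioo
  have h1 := (contDiffOn_fderiv_apply hO h.contDiffOn_Ioo (0, 1)).continuousOn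
  have h2 := h1.comp (f := fun q : USphere (EuclideanSpace ℝ (Fin (m + 1))) × ℝ =>
    ((q.1 : EuclideanSpace ℝ (Fin (m + 1))), q.2)) (s := Set.univ ×ˢ Set.Ioo 0 t₀)
    (by fun_prop) (fun q hq => ⟨coe_usphere_ne_zero q.1, hq.2⟩)
  refine h2.congr fun q hq => ?_
  rw [Function.comp_apply, h.fderiv_time hq.2 (coe_usphere_ne_zero q.1), radialExt_coe]

theorem continuousOn_speed_slice (ht₀ : 0 < t₀)
    (z : USphere (EuclideanSpace ℝ (Fin (m + 1)))) : ContinuousOn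
    (fun τ => Φ z * detRadii (supportFunction (K τ)) z ^ (p / m)) (Set.Icc 0 t₀) := by
  have h1 : ContDiffOn ℝ ∞ (fun τ => supportFunction (K τ) z) (Set.Icc 0 t₀) := by
    have := h.contDiffOn.comp (f := fun τ => ((z : EuclideanSpace ℝ (Fin (m + 1))), τ))
      (contDiff_const.prodMk contDiff_id).contDiffOn (s := Set.Icc 0 t₀)
      (fun τ hτ => ⟨coe_usphere_ne_zero z, hτ⟩)
    refine this.congr fun τ _ => ?_
    exact (radialExt_coe _ z).symm
  refine (h1.continuousOn_derivWithin (uniqueDiffOn_Icc ht₀) (by simp)).congr fun τ hτ => ?_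
  exact ((h.evolution τ hτ z).derivWithin (uniqueDiffOn_Icc ht₀ τ hτ)).symm

end IsSmoothStrictlyConvexSolution

end Flow

/-! ### The minimum principle for a power of the speed -/

section Estimate

variable {m : ℕ} {p t₀ : ℝ} {Φ : USphere (EuclideanSpace ℝ (Fin (m + 1))) → ℝ}
  {K : ℝ → ConvexBody (EuclideanSpace ℝ (Fin (m + 1)))}

/-- A function which on `[a, t]` is minimal at `t` has nonpositive derivative there. -/
theorem deriv_nonpos_of_forall_le {g : ℝ → ℝ} {d a t : ℝ} (hat : a < t) (hg : HasDerivAt g d t)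
    (hmin : ∀ τ ∈ Set.Icc a t, g t ≤ g τ) : d ≤ 0 := by
  have h := hg.hasDerivWithinAt.hasFDerivWithinAt (s := Set.Icc a t)
  have hloc : IsLocalMinOn g (Set.Icc a t) t :=
    Filter.eventually_of_mem self_mem_nhdsWithin hmin
  have := hloc.hasFDerivWithinAt_nonneg h (y := a - t)
    (sub_mem_posTangentConeAt_of_segment_subset
      ((convex_Icc a t).segment_subset (Set.right_mem_Icc.2 hat.le) (Set.left_mem_Icc.2 hat.le)))
  simp only [ContinuousLinearMap.toSpanSingleton_apply, smul_eq_mul] at this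
  nlinarith

theorem mul_rpow_speed {φ S : ℝ} (hφ : 0 < φ) (hS : 0 < S) (hp : 0 < p) (m : ℕ) :
    (φ * S ^ (p / m)) ^ ((1 - p) / p) = φ ^ ((1 - p) / p) * S ^ ((1 - p) / m) := by
  rw [Real.mul_rpow hφ.le (Real.rpow_nonneg hS.le _), ← Real.rpow_mul hS.le]
  congr 2
  field_simp

namespace IsSmoothStrictlyConvexSolution

variable (h : IsSmoothStrictlyConvexSolution m p t₀ Φ K)

include h

/-- The maximum principle: `c t` is a lower barrier for the power `(1 - p) / p` of the speed. -/
theorem mul_sub_le_speed_rpow (hm : 1 ≤ m) (hp0 : 0 < p) (hp1 : p < 1) (hΦ : ∀ z, 0 < Φ z)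
    {c : ℝ} (hc : ∀ z, c < (1 - p) * Φ z ^ (1 / p)) {a b : ℝ} (ha : 0 < a) (hb : b < t₀) {t : ℝ}
    (ht : t ∈ Set.Icc a b) (z : USphere (EuclideanSpace ℝ (Fin (m + 1)))) :
    c * (t - a) ≤ (Φ z * detRadii (supportFunction (K t)) z ^ (p / m)) ^ ((1 - p) / p) := by
  have hsub : Set.Icc a b ⊆ Set.Ioo 0 t₀ := fun τ hτ => ⟨ha.trans_le hτ.1, hτ.2.trans_lt hb⟩
  have hspeed : ∀ τ ∈ Set.Ioo 0 t₀, ∀ w,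
      0 < Φ w * detRadii (supportFunction (K τ)) w ^ (p / m) := fun τ hτ w =>
    mul_pos (hΦ w) (Real.rpow_pos_of_pos (h.detRadii_pos (Set.Ioo_subset_Icc_self hτ) w) _)
  have hm0 : (0 : ℝ) < m := by exact_mod_cast hm
  set g : USphere (EuclideanSpace ℝ (Fin (m + 1))) × ℝ → ℝ := fun q =>
    (Φ q.1 * detRadii (supportFunction (K q.2)) q.1 ^ (p / m)) ^ ((1 - p) / p)
      - c * (q.2 - a) with hg
  have hcont : ContinuousOn g (Set.univ ×ˢ Set.Icc a b) := by
    refine ContinuousOn.sub ?_ (by fun_prop)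
    exact (h.continuousOn_speed.mono (Set.prod_mono le_rfl hsub)).rpow_const
      fun q hq => Or.inl (hspeed q.2 (hsub hq.2) q.1).ne'
  obtain ⟨⟨z₁, t₁⟩, ⟨-, ht₁⟩, hmin⟩ := (isCompact_univ.prod isCompact_Icc).exists_isMinOn
    ⟨(z, t), Set.mem_univ _, ht⟩ hcont
  have hmin' : ∀ w, ∀ τ ∈ Set.Icc a b, g (z₁, t₁) ≤ g (w, τ) := fun w τ hτ =>
    hmin (show (w, τ) ∈ _ from ⟨Set.mem_univ _, hτ⟩)
  have ht₁' := hsub ht₁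
  -- At a minimum with t₁ > a the time derivative of g would be nonpositive, whereas spatial
  -- minimality bounds it below by (1-p) Φ^(1/p) - c > 0. At t₁ = a, g is nonnegative.
  suffices hle : t₁ ≤ a by
    have h1 : 0 ≤ g (z₁, t₁) := by
      have h2 := Real.rpow_nonneg (hspeed t₁ ht₁' z₁).le ((1 - p) / p)
      have h3 : t₁ = a := le_antisymm hle ht₁.1
      simp only [hg, h3, sub_self, mul_zero, sub_zero] at h2 ⊢
      exact h2
    have h2 := h1.trans (hmin' z t ht)
    simp only [hg] at h2
    linarith
  by_contra! hlt
  obtain ⟨d, hd, hdge⟩ := h.exists_hasDerivAt_detRadii_ge hm hΦ ht₁' (z := z₁) (fun w => by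
    have h1 := hmin' w t₁ ht₁
    simp only [hg, sub_le_sub_iff_right] at h1
    exact (Real.rpow_le_rpow_iff (hspeed t₁ ht₁' z₁).le (hspeed t₁ ht₁' w).le
      (div_pos (by linarith) hp0)).1 h1)
  set S := detRadii (supportFunction (K t₁)) z₁ with hS
  have hSpos : 0 < S := h.detRadii_pos (Set.Ioo_subset_Icc_self ht₁') z₁
  set β : ℝ := (1 - p) / m with hβ
  have hβ0 : 0 < β := div_pos (by linarith) hm0
  have hderiv : HasDerivAt (fun τ => g (z₁, τ))
      (Φ z₁ ^ ((1 - p) / p) * (d * β * S ^ (β - 1)) - c) t₁ := by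
    have h1 := ((hd.rpow_const (p := β) (Or.inl hSpos.ne')).const_mul (Φ z₁ ^ ((1 - p) / p))).sub
      (((hasDerivAt_id t₁).sub_const a).const_mul c)
    rw [mul_one] at h1
    refine h1.congr_of_eventuallyEq ?_
    filter_upwards [Ioo_mem_nhds ht₁'.1 ht₁'.2] with τ hτ
    simp only [hg, mul_rpow_speed (hΦ z₁) (h.detRadii_pos (Set.Ioo_subset_Icc_self hτ) z₁) hp0]
    rfl
  have hnonpos := deriv_nonpos_of_forall_le hlt hderiv
    fun τ hτ => hmin' z₁ τ ⟨hτ.1, hτ.2.trans ht₁.2⟩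
  -- The exponents p/m + 1 - 1/m + β - 1 add up to 0; this cancellation dictates the power (1-p)/p
  -- of the speed.
  have hpow : S ^ (p / m) * S * S ^ (-(1 / (m : ℝ))) * S ^ (β - 1) = 1 := by
    nth_rewrite 2 [← Real.rpow_one S]
    rw [← Real.rpow_add hSpos, ← Real.rpow_add hSpos, ← Real.rpow_add hSpos]
    convert Real.rpow_zero S using 2
    rw [hβ]
    field_simp
    ring
  have hΦpow : Φ z₁ ^ ((1 - p) / p) * Φ z₁ = Φ z₁ ^ (1 / p) := by
    nth_rewrite 2 [← Real.rpow_one (Φ z₁)]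
    rw [← Real.rpow_add (hΦ z₁)]
    congr 1
    field_simp
    ring
  have hkey : (1 - p) * Φ z₁ ^ (1 / p) ≤ Φ z₁ ^ ((1 - p) / p) * (d * β * S ^ (β - 1)) := by
    have hmβ : (m : ℝ) * β = 1 - p := by rw [hβ]; field_simp
    calc (1 - p) * Φ z₁ ^ (1 / p)
        = Φ z₁ ^ ((1 - p) / p) * ((m * (Φ z₁ * S ^ (p / m)) * S * S ^ (-(1 / (m : ℝ))))
            * β * S ^ (β - 1)) := by
          rw [← hΦpow]
          linear_combination (-(Φ z₁ ^ ((1 - p) / p) * Φ z₁)) * hmβ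
            - m * β * (Φ z₁ ^ ((1 - p) / p) * Φ z₁) * hpow
      _ ≤ _ := by
          have h1 := Real.rpow_nonneg (hΦ z₁).le ((1 - p) / p)
          have h2 := Real.rpow_nonneg hSpos.le (β - 1)
          gcongr
  linarith [hc z₁]

/-- The barrier started at a > 0 stays within the open time interval, where two-sided time
derivatives are available. Letting a tend to 0 removes the delay, and continuity of the speed
reaches the final time. -/
theorem mul_le_speed_rpow (hm : 1 ≤ m) (hp0 : 0 < p) (hp1 : p < 1) (hΦ : ∀ z, 0 < Φ z)
    {c : ℝ} (hc : ∀ z, c < (1 - p) * Φ z ^ (1 / p)) {t : ℝ} (ht : t ∈ Set.Ioc 0 t₀)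
    (z : USphere (EuclideanSpace ℝ (Fin (m + 1)))) :
    c * t ≤ (Φ z * detRadii (supportFunction (K t)) z ^ (p / m)) ^ ((1 - p) / p) := by
  have hopen : ∀ τ ∈ Set.Ioo 0 t₀,
      c * τ ≤ (Φ z * detRadii (supportFunction (K τ)) z ^ (p / m)) ^ ((1 - p) / p) := by
    intro τ hτ
    have hlim : Filter.Tendsto (fun a => c * (τ - a)) (nhdsWithin 0 (Set.Ioi 0))
        (nhds (c * τ)) :=
      (Continuous.tendsto' (by fun_prop) 0 _ (by simp)).mono_left nhdsWithin_le_nhds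
    refine le_of_tendsto hlim ?_
    filter_upwards [Ioo_mem_nhdsGT hτ.1] with a ha
    exact h.mul_sub_le_speed_rpow hm hp0 hp1 hΦ hc ha.1 hτ.2 ⟨ha.2.le, le_rfl⟩ z
  have ht₀ : 0 < t₀ := ht.1.trans_le ht.2
  have hcont : ContinuousOn (fun τ =>
      (Φ z * detRadii (supportFunction (K τ)) z ^ (p / m)) ^ ((1 - p) / p)) (Set.Icc 0 t₀) :=
    (h.continuousOn_speed_slice ht₀ z).rpow_const fun _ _ => Or.inr (by
      have := sub_pos.2 hp1
      positivity)
  have htI := Set.Ioc_subset_Icc_self ht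
  have hcl : t ∈ closure (Set.Ioo 0 t₀) := by rwa [closure_Ioo ht₀.ne]
  exact ContinuousWithinAt.closure_le hcl (by fun_prop)
    ((hcont t htI).mono Set.Ioo_subset_Icc_self) hopen

end IsSmoothStrictlyConvexSolution

end Estimate

end ExpandingGaussFlow

/-! ### The curvature bound -/

theorem lemma4p1 (m : ℕ) (hm : 1 ≤ m) (p : ℝ) (hp0 : 0 < p) (hp1 : p < 1)
    (Rminus Rplus : ℝ) (hR : 0 < Rminus)
    (Φ : ExpandingGaussFlow.USphere (EuclideanSpace ℝ (Fin (m + 1))) → ℝ)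
    (hΦ_smooth : ContMDiff (𝓡 m) 𝓘(ℝ, ℝ) ∞ Φ) (hΦ_pos : ∀ z, 0 < Φ z) :
    ∃ C : ℝ, 0 < C ∧
      ∀ (t₀ : ℝ) (K : ℝ → ConvexBody (EuclideanSpace ℝ (Fin (m + 1)))),
        ExpandingGaussFlow.IsSmoothStrictlyConvexSolution m p t₀ Φ K →
        (∀ t ∈ Set.Icc 0 t₀, ∀ z,
          Rminus ≤ ExpandingGaussFlow.supportFunction (K t) z ∧
            ExpandingGaussFlow.supportFunction (K t) z ≤ Rplus) →
        ∀ t ∈ Set.Ioc 0 t₀, ∀ x ∈ frontier (K t : Set (EuclideanSpace ℝ (Fin (m + 1)))),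
          ExpandingGaussFlow.gaussCurvature (K t) x ≤ C * t ^ ((m : ℝ) / (p - 1)) := by
  have hm0 : (0 : ℝ) < m := by exact_mod_cast hm
  have h1p : 0 < 1 - p := sub_pos.2 hp1
  have hΦc : Continuous Φ := hΦ_smooth.continuous
  have : Nonempty (ExpandingGaussFlow.USphere (EuclideanSpace ℝ (Fin (m + 1)))) :=
    (NormedSpace.sphere_nonempty.2 zero_le_one).to_subtype
  obtain ⟨z₀, -, hz₀⟩ := isCompact_univ.exists_isMinOn Set.univ_nonempty hΦc.continuousOn
  obtain ⟨z₁, -, hz₁⟩ := isCompact_univ.exists_isMaxOn Set.univ_nonempty hΦc.continuousOn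
  -- Half the minimum of (1-p) Φ^(1/p) leaves the strict inequality that the barrier needs.
  set c : ℝ := (1 - p) * Φ z₀ ^ (1 / p) / 2 with hc
  have hpos₀ : 0 < (1 - p) * Φ z₀ ^ (1 / p) :=
    mul_pos h1p (Real.rpow_pos_of_pos (hΦ_pos z₀) _)
  have hc0 : 0 < c := half_pos hpos₀
  have hcΦ : ∀ z, c < (1 - p) * Φ z ^ (1 / p) := fun z => (half_lt_self hpos₀).trans_le
    (mul_le_mul_of_nonneg_left (Real.rpow_le_rpow (hΦ_pos z₀).le (hz₀ (Set.mem_univ z))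
      (by positivity)) h1p.le)
  set M : ℝ := Φ z₁ ^ ((1 - p) / p) with hM
  have hM0 : 0 < M := Real.rpow_pos_of_pos (hΦ_pos z₁) _
  -- With M the maximum of Φ^((1-p)/p), the barrier gives S^((1-p)/m) ≥ (c/M) t; raising this to the
  -- negative power m/(p-1) bounds 1/S from above.
  refine ⟨(c / M) ^ ((m : ℝ) / (p - 1)), Real.rpow_pos_of_pos (div_pos hc0 hM0) _, ?_⟩
  intro t₀ K hK hR' t ht x hx
  have htI := Set.Ioc_subset_Icc_self ht
  have hs := hK.contDiffAt_slice htI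
  have hs0 : ∀ z, 0 < ExpandingGaussFlow.supportFunction (K t) z := fun z =>
    hR.trans_le (hR' t htI z).1
  have hint : (interior (K t : Set (EuclideanSpace ℝ (Fin (m + 1))))).Nonempty :=
    ⟨0, ExpandingGaussFlow.zero_mem_interior hR fun z => (hR' t htI z).1⟩
  obtain ⟨z, rfl⟩ := ExpandingGaussFlow.exists_eq_inverseGauss hs hint hx
  have hcurv := ExpandingGaussFlow.gaussCurvature_mul_detRadii hs (hK.strictlyConvex t htI) hs0
    hint z
  have hS := hK.detRadii_pos htI z
  have hle := hK.mul_le_speed_rpow hm hp0 hp1 hΦ_pos hcΦ ht z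
  rw [ExpandingGaussFlow.mul_rpow_speed (hΦ_pos z) hS hp0] at hle
  set S := ExpandingGaussFlow.detRadii (ExpandingGaussFlow.supportFunction (K t)) z
  have hle' : c / M * t ≤ S ^ ((1 - p) / m) := by
    rw [div_mul_eq_mul_div, div_le_iff₀' hM0]
    exact hle.trans (mul_le_mul_of_nonneg_right (Real.rpow_le_rpow (hΦ_pos z).le
      (hz₁ (Set.mem_univ z)) (by positivity)) (Real.rpow_nonneg hS.le _))
  have hneg : (m : ℝ) / (p - 1) ≤ 0 := div_nonpos_of_nonneg_of_nonpos hm0.le (by linarith)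
  rw [eq_inv_of_mul_eq_one_left hcurv, ← Real.mul_rpow (div_pos hc0 hM0).le ht.1.le]
  calc S⁻¹ = (S ^ ((1 - p) / m)) ^ ((m : ℝ) / (p - 1)) := by
        rw [← Real.rpow_mul hS.le, ← Real.rpow_neg_one]
        congr 1
        have : p - 1 ≠ 0 := by linarith
        field_simp
        ring
    _ ≤ _ := Real.rpow_le_rpow_of_nonpos (mul_pos (div_pos hc0 hM0) ht.1) hle' hneg
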